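/- Let $\Sigma$ be a finite non-empty linearly ordered alphabet with $\sigma=|\Sigma|$ symbols, $\hat\sigma=\max\{2,\sigma\}$, and let $\Box\in\Sigma$ be a fixed symbol. *Trees and entropy.* $\mathcal T$ is the set of binary trees $t$ (every node has $0$ or $2$ children) whose nodes are labelled by $\Sigma$, and $\mathcal T_n$ is the set of those with $n$ leaves. For a node $v$ of $t$ let $\lambda(v)\in\Sigma\times\{0,2\}$ be its label together with its number of children. The history $h(v)\in(\Sigma\{0,1\})^*$ lists, from the root downwards, for every edge on the path from the root to $v$ the label of the upper node and the direction ($0$ left, $1$ right). The $k$-history of $v$ is the suffix of length $2k$ of $(\Box 0)^k h(v)$. For $z\in(\Sigma\{0,1\})^k$ let $m_z$ be the number of nodes with $k$-history $z$ and, if $m_z>0$, let $P_z$ be the empirical distribution of $\lambda(v)$ on these nodes. The $k$-th order (unnormalized) empirical entropy is $H_k(t)=\sum_{z:\,m_z>0} m_z H(P_z)$, where $H$ is the Shannon entropy in bits. *Grammars.* A context is a binary tree in which exactly one leaf is labelled by a parameter $x\notin\Sigma$ and all other nodes are labelled by $\Sigma$. A normal form TSLP $\mathcal G$ has nonterminals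 $A_0,\dots,A_{m-1}$, each of rank $0$ (deriving a tree) or $1$ (deriving a context), the start nonterminal $A_0$ having rank $0$, with one rule for each nonterminal. The right-hand side is $A_j(\alpha)$ for rank $0$, and $A_j(A_k(x))$, $a(\alpha,x)$ or $a(x,\alpha)$ for rank $1$, where $A_j,A_k$ have rank $1$, $a\in\Sigma$, and $\alpha$ is a letter or a nonterminal of rank $0$. The relation "occurs in the right-hand side of" is acyclic, and distinct nonterminals derive distinct trees or contexts. With $\rho(A_i)=A_j\alpha$, $A_jA_k$, $a\alpha$, $a\alpha$ in the four cases, $\rho=\rho(A_0)\cdots\rho(A_{m-1})$ has the form $A_1u_1A_2u_2\cdots A_{m-1}u_{m-1}$ with $u_i\in(\Sigma\cup\{A_1,\dots,A_i\})^*$. The one-rule TSLPs $A_0\to a$ ($a\in\Sigma$) are also allowed. The size is $|\mathcal G|=m$. *Encoding.* $B(\mathcal G)=w_0w_1w_2w_3w_4$, where $w_0=0^{m-1}1$; $w_1$ lists for $A_0,\dots,A_{m-1}$ the two-bit code of the type of the right-hand side (types $0,1,2,3$ for $A_j(\alpha)$, $A_j(A_k(x))$, $a(\alpha,x)$, $a(x,\alpha)$);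 $w_2=10^{|u_1|}\cdots10^{|u_{m-1}|}$; $w_3=0^{k_1-1}1\cdots0^{k_{m-1}-1}1\,0^{l_1}1\cdots0^{l_\sigma}1$, where $k_i$ and $l_i$ are the numbers of occurrences in $\rho$ of $A_i$ and of the $i$-th letter; and $w_4$ is the index of $\omega=u_1\cdots u_{m-1}$ in the lexicographic enumeration (letters before nonterminals) of the set $S$ of all rearrangements of $\omega$, written in binary with $\lceil\log_2|S|\rceil$ bits. A grammar-based tree compressor $\psi$ maps every $t\in\mathcal T$ to a normal form TSLP $\mathcal G_t$ that derives $t$; put $E_\psi(t)=B(\mathcal G_t)$. **Theorem.** For every $\gamma>0$ there is a constant $C>0$, depending only on $\gamma$, such that the following holds for all $\Sigma$, $\Box$ and $\psi$ as above and all $n\ge2$ (so $\sigma$ may vary with $n$). If $|\mathcal G_t|\le\gamma n/\log_{\hat\sigma}n$ for all $t\in\mathcal T_n$, then for all $t\in\mathcal T_n$ and all $k\ge0$ $$|E_\psi(t)|\le H_k(t)+C\,\frac{kn\log_2\hat\sigma}{\log_{\hat\sigma}n}+C\,\frac{n\max\{1,\log_2\log_{\hat\sigma}n\}}{\log_{\hat\sigma}n}+\sigma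 ,$$ and moreover, whenever $k\ge1$ or $n\ge\hat\sigma^2$, $$|E_\psi(t)|\le H_k(t)+C\,\frac{kn\log_2\hat\sigma}{\log_{\hat\sigma}n}+C\,\frac{n\log_2\log_{\hat\sigma}n}{\log_{\hat\sigma}n}+\sigma .$$ -/

import Mathlib

/-- Labelled binary trees over the alphabet `α`: `leaf a` is the term `a` and `node a l r`
is the term `a(l, r)`. -/
inductive BTree (α : Type*) where
  | leaf (a : α) : BTree α
  | node (a : α) (l r : BTree α) : BTree α

namespace BTree

variable {α : Type*}

/-- The number of leaves `|t|`. -/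
def leaves : BTree α → ℕ
  | leaf _ => 1
  | node _ l r => l.leaves + r.leaves

/-- The set of nodes, a node being the bit string of the path from the root
(`false` is `0`, left; `true` is `1`, right). -/
def nodes : BTree α → Finset (List Bool)
  | leaf _ => {[]}
  | node _ l r =>
      insert [] (l.nodes.image (fun w => false :: w) ∪ r.nodes.image (fun w => true :: w))

/-- The pair (label, number of children) of a node; the second component is `false` for
a leaf (no children) and `true` for an internal node (two children). It is `none` for bit
strings which are not nodes of the tree. -/
def label : BTree α → List Bool → Option (α × Bool)
  | leaf a, [] => some (a, false)
  | leaf _, _ :: _ => none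
  | node a _ _, [] => some (a, true)
  | node _ l _, false :: w => l.label w
  | node _ _ r, true :: w => r.label w

/-- The history of a node: the labels of its proper ancestors together with the
directions taken, read from the root downwards. -/
def history : BTree α → List Bool → List (α × Bool)
  | leaf _, _ => []
  | node _ _ _, [] => []
  | node a l _, false :: w => (a, false) :: l.history w
  | node a _ r, true :: w => (a, true) :: r.history w

/-- The `k`-history of a node: the last `k` pairs of the history padded on the left with
`k` copies of the pair `(box, 0)`. -/
def kHistory (box : α) (k : ℕ) (t : BTree α) (v : List Bool) : List (α × Bool) :=
  (List.replicate k (box, false) ++ t.history v).drop (t.history v).length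

variable [DecidableEq α]

/-- The number of nodes of `t` with `k`-history `z`. -/
def histCount (box : α) (k : ℕ) (t : BTree α) (z : List (α × Bool)) : ℕ :=
  (t.nodes.filter (fun v => t.kHistory box k v = z)).card

/-- The number of nodes `v` of `t` with `k`-history `z` and (label, number of children)
equal to `b`. -/
def histLabelCount (box : α) (k : ℕ) (t : BTree α) (z : List (α × Bool)) (b : α × Bool) : ℕ :=
  (t.nodes.filter (fun v => t.kHistory box k v = z ∧ t.label v = some b)).card

/-- The empirical distribution at the `k`-history `z` (only meaningful if some node has
the `k`-history `z`). -/
noncomputable def empirical (box : α) (k : ℕ) (t : BTree α) (z : List (α × Bool))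
    (b : α × Bool) : ℝ :=
  (t.histLabelCount box k z b : ℝ) / (t.histCount box k z : ℝ)

end BTree

/-- Shannon entropy, in bits, of a function on a finite set. -/
noncomputable def shannonEntropy {A : Type*} [Fintype A] (p : A → ℝ) : ℝ :=
  ∑ a, -(p a * Real.logb 2 (p a))

/-- The `k`-th order (unnormalized) empirical entropy of a tree; the sum runs over all
words `z` of length `k` over `α × {0,1}`. -/
noncomputable def BTree.empiricalEntropy {α : Type*} [Fintype α] [DecidableEq α]
    (box : α) (k : ℕ) (t : BTree α) : ℝ :=
  ∑ z : List.Vector (α × Bool) k,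
    (t.histCount box k z.toList : ℝ) * shannonEntropy (t.empirical box k z.toList)

/-- Binary trees whose leaves may also carry the parameter `x`. The trees are those
without `x`, the contexts are those with exactly one occurrence of `x`. -/
inductive PTree (α : Type*) where
  | x : PTree α
  | leaf (a : α) : PTree α
  | node (a : α) (l r : PTree α) : PTree α

/-- Replace the parameter `x` in the first argument by the second argument. -/
def PTree.subst {α : Type*} : PTree α → PTree α → PTree α
  | .x, s => s
  | .leaf a, _ => .leaf a
  | .node a l r, s => .node a (l.subst s) (r.subst s)

/-- A tree, seen as a tree without parameter. -/
def BTree.toPTree {α : Type*} : BTree α → PTree α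
  | .leaf a => .leaf a
  | .node a l r => .node a l.toPTree r.toPTree

/-- Right-hand sides of normal form rules with nonterminals `A_0, …, A_p`. A symbol from
`α ⊕ Fin (p + 1)` is a letter (`inl`) or a nonterminal (`inr`). -/
inductive NFRhs (α : Type*) (p : ℕ) where
  /-- `A_j(s)` -/
  | app (j : Fin (p + 1)) (s : α ⊕ Fin (p + 1)) : NFRhs α p
  /-- `A_j(A_k(x))` -/
  | comp (j k : Fin (p + 1)) : NFRhs α p
  /-- `a(s, x)` -/
  | nodeL (a : α) (s : α ⊕ Fin (p + 1)) : NFRhs α p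
  /-- `a(x, s)` -/
  | nodeR (a : α) (s : α ⊕ Fin (p + 1)) : NFRhs α p

namespace NFRhs

variable {α : Type*} {p : ℕ}

/-- The rank of a nonterminal with this right-hand side: `0` if the right-hand side is a
tree, `1` if it is a context. -/
def rank : NFRhs α p → ℕ
  | app _ _ => 0
  | _ => 1

/-- The word `ρ(A)` of length two for a nonterminal `A` with this right-hand side. -/
def rho : NFRhs α p → List (α ⊕ Fin (p + 1))
  | app j s => [Sum.inr j, s]
  | comp j k => [Sum.inr j, Sum.inr k]
  | nodeL a s => [Sum.inl a, s]
  | nodeR a s => [Sum.inl a, s]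

/-- The two-bit binary code of the type `0`, `1`, `2` or `3`. -/
def typeBits : NFRhs α p → List Bool
  | app _ _ => [false, false]
  | comp _ _ => [false, true]
  | nodeL _ _ => [true, false]
  | nodeR _ _ => [true, true]

/-- The symbol is a letter or a nonterminal of rank `0`. -/
def IsTreeSym (r : Fin (p + 1) → NFRhs α p) (s : α ⊕ Fin (p + 1)) : Prop :=
  ∀ i, s = Sum.inr i → (r i).rank = 0

/-- Ranks are respected in a right-hand side of the system of rules `r`. -/
def WellRanked (r : Fin (p + 1) → NFRhs α p) : NFRhs α p → Prop
  | app j s => (r j).rank = 1 ∧ IsTreeSym r s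
  | comp j k => (r j).rank = 1 ∧ (r k).rank = 1
  | nodeL _ s => IsTreeSym r s
  | nodeR _ s => IsTreeSym r s

end NFRhs

/-- Tree straight-line programs with nonterminals `A_0, …, A_p`, start nonterminal `A_0`
of rank `0`, and right-hand sides of the shapes allowed in normal form. -/
structure RawTSLP (α : Type*) where
  /-- the number of nonterminals minus one -/
  p : ℕ
  rhs : Fin (p + 1) → NFRhs α p
  rank_start : (rhs 0).rank = 0
  wellRanked : ∀ i, NFRhs.WellRanked rhs (rhs i)
  acyclic : ∀ i, ¬ Relation.TransGen (fun i j => Sum.inr j ∈ (rhs i).rho) i i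

namespace RawTSLP

variable {α : Type*} (G : RawTSLP α)

/-- `A_j` occurs in the right-hand side of `A_i`. -/
def Occurs (j i : Fin (G.p + 1)) : Prop := Sum.inr j ∈ (G.rhs i).rho

theorem wf_occurs : WellFounded G.Occurs := by
  have hirr : Std.Irrefl (Relation.TransGen G.Occurs) := by
    refine ⟨fun i hi => G.acyclic i ?_⟩
    have h := Relation.transGen_swap.mpr hi
    exact h
  have h : WellFounded (Relation.TransGen G.Occurs) := Finite.wellFounded_of_trans_of_irrefl _
  exact Subrelation.wf (fun h => Relation.TransGen.single h) h

/-- The tree or context derived from a nonterminal. -/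
def val (i : Fin (G.p + 1)) : PTree α :=
  match h : G.rhs i with
  | .app j (.inl a) => (val j).subst (.leaf a)
  | .app j (.inr k) => (val j).subst (val k)
  | .comp j k => (val j).subst (val k)
  | .nodeL a (.inl b) => .node a (.leaf b) .x
  | .nodeL a (.inr k) => .node a (val k) .x
  | .nodeR a (.inl b) => .node a .x (.leaf b)
  | .nodeR a (.inr k) => .node a .x (val k)
termination_by G.wf_occurs.wrap i
decreasing_by all_goals simp [WellFounded.wrap, Occurs, h, NFRhs.rho]

/-- The word `ρ(A_0) ρ(A_1) ⋯ ρ(A_p)`. -/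
def rhoWord : List (α ⊕ Fin (G.p + 1)) :=
  (List.ofFn (fun i => (G.rhs i).rho)).flatten

end RawTSLP

/-- Normal form TSLPs, except for those which consist of a single rule `A_0 → a`. The
words `u_1, …, u_p` (here `u 0, …, u (p-1)`) in the factorization
`ρ = A_1 u_1 A_2 u_2 ⋯ A_p u_p` are determined by the rules. -/
structure ProperTSLP (α : Type*) extends RawTSLP α where
  u : Fin p → List (α ⊕ Fin (p + 1))
  rhoWord_eq : toRawTSLP.rhoWord = (List.ofFn (fun i => Sum.inr i.succ :: u i)).flatten
  mem_u : ∀ i j, Sum.inr j ∈ u i → 1 ≤ (j : ℕ) ∧ (j : ℕ) ≤ (i : ℕ) + 1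
  val_injective : Function.Injective toRawTSLP.val

/-- TSLPs in normal form; `single a` is the TSLP with the single rule `A_0 → a`. -/
inductive NormalFormTSLP (α : Type*) where
  | single (a : α) : NormalFormTSLP α
  | proper (G : ProperTSLP α) : NormalFormTSLP α

/-- Lexicographic order on words over letters and nonterminals, where all letters come
before all nonterminals. -/
def wordLT {α : Type*} [LinearOrder α] {q : ℕ} (v w : List (α ⊕ Fin q)) : Prop :=
  List.Lex (Sum.Lex (· < ·) (· < ·)) v w

/-- Enumerative code of a word `w`: the index of `w` in the lexicographic enumeration
(starting with index `0`) of the set `S` of all rearrangements of `w`, written in binary,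
most significant bit first, with exactly `⌈log₂ |S|⌉` bits. -/
noncomputable def enumerativeCode {α : Type*} [LinearOrder α] {q : ℕ}
    (w : List (α ⊕ Fin q)) : List Bool :=
  (List.range (Nat.clog 2 {v : List (α ⊕ Fin q) | v.Perm w}.ncard)).reverse.map
    (fun b => {v : List (α ⊕ Fin q) | v.Perm w ∧ wordLT v w}.ncard.testBit b)

namespace ProperTSLP

variable {α : Type*} (G : ProperTSLP α)

/-- The word `ω = u_1 u_2 ⋯ u_p`. -/
def omegaWord : List (α ⊕ Fin (G.p + 1)) := (List.ofFn G.u).flatten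

def w0 : List Bool := List.replicate G.p false ++ [true]

def w1 : List Bool := (List.ofFn (fun i => (G.rhs i).typeBits)).flatten

def w2 : List Bool :=
  (List.ofFn (fun i => true :: List.replicate (G.u i).length false)).flatten

def w3 [Fintype α] [LinearOrder α] : List Bool :=
  (List.ofFn (fun i : Fin G.p =>
      List.replicate (G.rhoWord.count (Sum.inr i.succ) - 1) false ++ [true])).flatten ++
    ((Finset.univ : Finset α).sort (· ≤ ·)).flatMap
      (fun a => List.replicate (G.rhoWord.count (Sum.inl a)) false ++ [true])

noncomputable def w4 [LinearOrder α] : List Bool := enumerativeCode G.omegaWord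

end ProperTSLP

namespace NormalFormTSLP

variable {α : Type*}

/-- The number of nonterminals. -/
def size : NormalFormTSLP α → ℕ
  | single _ => 1
  | proper G => G.p + 1

/-- The tree derived from the start nonterminal. -/
def val : NormalFormTSLP α → PTree α
  | single a => .leaf a
  | proper G => G.toRawTSLP.val 0

/-- The binary encoding `B(G) = w_0 w_1 w_2 w_3 w_4`. For the TSLP `A_0 → a` one has
`ρ = ω = a`, there are no `A_i` with `i ≥ 1`, so that `w_2` is empty, and there is a single
rearrangement of `ω`, so that `w_4` is empty; the type of `A_0` is taken to be `0`. -/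
noncomputable def encode [Fintype α] [LinearOrder α] : NormalFormTSLP α → List Bool
  | single a => [true] ++ [false, false] ++
      ((Finset.univ : Finset α).sort (· ≤ ·)).flatMap
        (fun b => List.replicate (if b = a then 1 else 0) false ++ [true])
  | proper G => G.w0 ++ G.w1 ++ G.w2 ++ G.w3 ++ G.w4

end NormalFormTSLP

/-- Grammar-based tree compressors: every tree `t` is mapped to a normal form TSLP
deriving `t`. -/
structure TreeCompressor (α : Type*) where
  tslp : BTree α → NormalFormTSLP α
  val_tslp : ∀ t, (tslp t).val = t.toPTree

/-- The tree encoder `t ↦ B(G_t)`. -/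
noncomputable def TreeCompressor.encode {α : Type*} [Fintype α] [LinearOrder α]
    (ψ : TreeCompressor α) (t : BTree α) : List Bool :=
  (ψ.tslp t).encode

/-- `max {2, σ}` where `σ` is the size of the alphabet. -/
def sigmaHat (α : Type*) [Fintype α] : ℕ := max 2 (Fintype.card α)

/-- The logarithm of `n` to the base `max {2, σ}`. -/
noncomputable def logSigma (α : Type*) [Fintype α] (n : ℕ) : ℝ :=
  Real.logb (sigmaHat α) n

/-! The entropy `H_k(t)` is `-log₂` of the probability of `t` under a top-down process: the state at
a node is its `k`-history, and the node's label and arity are drawn from the empirical distribution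
at that state (`empiricalEntropy_eq`). The parts `w_0, …, w_3` cost at most `8|G| + σ` bits, so
everything rests on the number `|S|` of rearrangements of `ω`, which is compared with this
probability.

Let the likelihood of a symbol be the largest probability, over all starting states, of the piece it
derives. The likelihood of a nonterminal is at most the product over its right-hand side.
Multiplying these inequalities over all rules and cancelling `A_1, …, A_p`, each of which `ρ`
contains once beside `ω`, bounds the probability of `t` by the product of the likelihoods along `ω`
(`likelihood_start_le_prod`).

On the other side, `|S|` is at most the inverse of the probability of `ω` under any memoryless
source (`ncard_perm_mul_prod_le_one`). The source used averages the weight of a piece over the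
starting states and divides by the square of its size. It is a subprobability by a Kraft inequality
for the pairwise distinct values of the nonterminals. Trees have total mass at most one. Contexts do
so only once the preorder index of the parameter is fixed, which is what `scan` records; summing
over the index costs the quadratic discount.

A likelihood exceeds the source probability by a factor of at most `3 (2σ)^k (N + 2)²`, where `N` is
the size of the piece. The sizes along `ω` add up to `2n - 1`, so a tangent to the logarithm at a
threshold near `log n / log σ̂` bounds the sum of the `log₂ (N + 2)`. With `|G| = O(n / log_σ̂ n)`
this gives the error terms. -/

/-! ### Masses of trees and contexts under a top-down process -/

namespace PTree

variable {α Z : Type*}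

/-- The number of nodes other than the parameter. -/
def nodeCount : PTree α → ℕ
  | .x => 0
  | .leaf _ => 1
  | .node _ l r => l.nodeCount + r.nodeCount + 1

/-- The number of occurrences of the parameter. -/
def paramCount : PTree α → ℕ
  | .x => 1
  | .leaf _ => 0
  | .node _ l r => l.paramCount + r.paramCount

/-- The product of the probabilities `p z b` over all nodes other than the parameter, where
`z` is the state in which the node is visited; states are propagated downwards by `step`. -/
def weight (step : Z → α × Bool → Z) (p : Z → α × Bool → ℝ) : Z → PTree α → ℝ
  | _, .x => 1
  | z, .leaf a => p z (a, false)
  | z, .node a l r =>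
      p z (a, true) * l.weight step p (step z (a, false)) * r.weight step p (step z (a, true))

/-- Scans the nodes in preorder. In the state `some i` exactly `i` further nodes have to be
read before the parameter, in the state `none` no parameter may follow. The result is the
state after the scan, or `none` if the scan fails. -/
def scan : PTree α → Option ℕ → Option (Option ℕ)
  | .x, some 0 => some none
  | .x, _ => none
  | .leaf _, some 0 => none
  | .leaf _, some (i + 1) => some (some i)
  | .leaf _, none => some none
  | .node _ _ _, some 0 => none
  | .node _ l r, some (i + 1) => (l.scan (some i)).bind r.scan
  | .node _ l r, none => (l.scan none).bind r.scan

def depth : PTree α → ℕ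
  | .x => 0
  | .leaf _ => 0
  | .node _ l r => max l.depth r.depth + 1

theorem subst_of_paramCount_eq_zero {c : PTree α} (hc : c.paramCount = 0) (s : PTree α) :
    c.subst s = c := by
  induction c with
  | x => simp [paramCount] at hc
  | leaf a => simp [subst]
  | node a l r ihl ihr =>
    simp only [paramCount, subst] at hc ⊢
    rw [ihl (by omega), ihr (by omega)]

theorem nodeCount_subst {c : PTree α} (hc : c.paramCount = 1) (s : PTree α) :
    (c.subst s).nodeCount = c.nodeCount + s.nodeCount := by
  induction c with
  | x => simp [subst, nodeCount]
  | leaf a => simp [paramCount] at hc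
  | node a l r ihl ihr =>
    simp only [paramCount, subst, nodeCount] at hc ⊢
    rcases Nat.eq_zero_or_pos l.paramCount with h | h
    · rw [subst_of_paramCount_eq_zero h, ihr (by omega)]; omega
    · rw [subst_of_paramCount_eq_zero (c := r) (by omega), ihl (by omega)]; omega

theorem paramCount_subst (c s : PTree α) :
    (c.subst s).paramCount = c.paramCount * s.paramCount := by
  induction c with
  | x => simp [subst, paramCount]
  | leaf a => simp [subst, paramCount]
  | node a l r ihl ihr => simp [subst, paramCount, ihl, ihr, add_mul]

theorem weight_nonneg {step : Z → α × Bool → Z} {p : Z → α × Bool → ℝ}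
    (hp : ∀ z b, 0 ≤ p z b) (z : Z) (c : PTree α) : 0 ≤ c.weight step p z := by
  induction c generalizing z with
  | x => simp [weight]
  | leaf a => exact hp _ _
  | node a l r ihl ihr => exact mul_nonneg (mul_nonneg (hp _ _) (ihl _)) (ihr _)

/-- The state in which the parameter is reached depends only on the path to it, hence on `c` and `z`
but not on the substituted tree. -/
theorem exists_weight_subst (step : Z → α × Bool → Z) (p : Z → α × Bool → ℝ) (z : Z)
    {c : PTree α} (hc : c.paramCount = 1) :
    ∃ z', ∀ s : PTree α, (c.subst s).weight step p z = c.weight step p z * s.weight step p z' := by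
  induction c generalizing z with
  | x => exact ⟨z, fun s => by simp [subst, weight]⟩
  | leaf a => simp [paramCount] at hc
  | node a l r ihl ihr =>
    simp only [paramCount] at hc
    rcases Nat.eq_zero_or_pos l.paramCount with h | h
    · obtain ⟨z', hz'⟩ := ihr (step z (a, true)) (by omega)
      refine ⟨z', fun s => ?_⟩
      simp only [subst, weight]
      rw [subst_of_paramCount_eq_zero h, hz']
      ring
    · obtain ⟨z', hz'⟩ := ihl (step z (a, false)) (by omega)
      refine ⟨z', fun s => ?_⟩
      simp only [subst, weight]
      rw [subst_of_paramCount_eq_zero (by omega : r.paramCount = 0), hz']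
      ring

theorem scan_none_of_paramCount_eq_zero {c : PTree α} (hc : c.paramCount = 0) :
    c.scan none = some none := by
  induction c with
  | x => simp [paramCount] at hc
  | leaf a => simp [scan]
  | node a l r ihl ihr =>
    simp only [paramCount] at hc
    simp [scan, ihl (by omega), ihr (by omega)]

theorem scan_some_of_paramCount_eq_zero {c : PTree α} (hc : c.paramCount = 0) (i : ℕ) :
    c.scan (some (i + c.nodeCount)) = some (some i) := by
  induction c generalizing i with
  | x => simp [paramCount] at hc
  | leaf a => simp [scan, nodeCount]
  | node a l r ihl ihr =>
    simp only [paramCount] at hc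
    have : i + (node a l r).nodeCount = (i + r.nodeCount + l.nodeCount) + 1 := by
      simp [nodeCount]; omega
    rw [this]
    simp [scan, ihl (by omega), ihr (by omega)]

/-- The witness is the preorder index of the parameter: the left subtree, if it has no parameter,
contributes all its nodes, and the root contributes one. -/
theorem exists_scan_of_paramCount_eq_one {c : PTree α} (hc : c.paramCount = 1) :
    ∃ i ≤ c.nodeCount, c.scan (some i) = some none := by
  induction c with
  | x => exact ⟨0, by simp [nodeCount], by simp [scan]⟩
  | leaf a => simp [paramCount] at hc
  | node a l r ihl ihr =>
    simp only [paramCount] at hc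
    rcases Nat.eq_zero_or_pos l.paramCount with h | h
    · obtain ⟨i, hi, hs⟩ := ihr (by omega)
      refine ⟨i + l.nodeCount + 1, by simp [nodeCount]; omega, ?_⟩
      simp [scan, scan_some_of_paramCount_eq_zero h, hs]
    · obtain ⟨i, hi, hs⟩ := ihl (by omega)
      refine ⟨i + 1, by simp [nodeCount]; omega, ?_⟩
      simp [scan, hs, scan_none_of_paramCount_eq_zero (by omega : r.paramCount = 0)]

/-- The mass of a set of inner nodes, grouped by the label and the left subtree. -/
theorem sum_node_le [Fintype α] {step : Z → α × Bool → Z} {p : Z → α × Bool → ℝ}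
    (hp : ∀ z b, 0 ≤ p z b) (z : Z) (D : Finset (PTree α))
    (L : Finset (PTree α)) (R : PTree α → Finset (PTree α))
    (hD : ∀ c ∈ D, ∃ a, ∃ l ∈ L, ∃ r ∈ R l, c = .node a l r)
    (hL : ∀ a, ∑ l ∈ L, l.weight step p (step z (a, false)) ≤ 1)
    (hR : ∀ a, ∀ l ∈ L, ∑ r ∈ R l, r.weight step p (step z (a, true)) ≤ 1) :
    ∑ c ∈ D, c.weight step p z ≤ ∑ a, p z (a, true) := by
  classical
  let U : Finset (Σ _ : α, Σ _ : PTree α, PTree α) :=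
    Finset.univ.sigma fun _ => L.sigma R
  let f : (Σ _ : α, Σ _ : PTree α, PTree α) → PTree α := fun u => .node u.1 u.2.1 u.2.2
  have hf : Function.Injective f := by
    rintro ⟨a, l, r⟩ ⟨a', l', r'⟩ h
    simp only [f, node.injEq] at h
    obtain ⟨rfl, rfl, rfl⟩ := h
    rfl
  have hsub : D ⊆ U.image f := by
    intro c hc
    obtain ⟨a, l, hl, r, hr, rfl⟩ := hD c hc
    exact Finset.mem_image.2 ⟨⟨a, l, r⟩, by simp [U, hl, hr], rfl⟩
  calc ∑ c ∈ D, c.weight step p z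
      ≤ ∑ c ∈ U.image f, c.weight step p z :=
        Finset.sum_le_sum_of_subset_of_nonneg hsub fun c _ _ => weight_nonneg hp z c
    _ = ∑ a, ∑ l ∈ L, ∑ r ∈ R l, (node a l r).weight step p z := by
        rw [Finset.sum_image hf.injOn, Finset.sum_sigma]
        refine Finset.sum_congr rfl fun a _ => ?_
        rw [Finset.sum_sigma]
    _ ≤ ∑ a, p z (a, true) := by
        refine Finset.sum_le_sum fun a _ => ?_
        calc ∑ l ∈ L, ∑ r ∈ R l, (node a l r).weight step p z
            = ∑ l ∈ L, p z (a, true) * l.weight step p (step z (a, false)) *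
                ∑ r ∈ R l, r.weight step p (step z (a, true)) := by
              simp only [weight, Finset.mul_sum]
          _ ≤ ∑ l ∈ L, p z (a, true) * l.weight step p (step z (a, false)) * 1 := by
              refine Finset.sum_le_sum fun l hl => ?_
              exact mul_le_mul_of_nonneg_left (hR a l hl)
                (mul_nonneg (hp _ _) (weight_nonneg hp _ _))
          _ = p z (a, true) * ∑ l ∈ L, l.weight step p (step z (a, false)) := by
              simp [Finset.mul_sum]
          _ ≤ p z (a, true) * 1 := mul_le_mul_of_nonneg_left (hL a) (hp _ _)
          _ = p z (a, true) := mul_one _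

/-- Kraft's inequality: the trees and contexts which can be scanned from a fixed state have
total mass at most one. -/
theorem sum_weight_le_one [Fintype α] {step : Z → α × Bool → Z} {p : Z → α × Bool → ℝ}
    (hp : ∀ z b, 0 ≤ p z b) (hp1 : ∀ z, ∑ b, p z b ≤ 1) (s : Option ℕ) (z : Z)
    (S : Finset (PTree α)) (hS : ∀ c ∈ S, (c.scan s).isSome) :
    ∑ c ∈ S, c.weight step p z ≤ 1 := by
  classical
  -- A common depth bound permits an induction in which the set, the scan state and the process
  -- state all change.
  obtain ⟨d, hd⟩ : ∃ d, ∀ c ∈ S, c.depth < d :=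
    ⟨S.sup depth + 1, fun c hc => Nat.lt_succ_of_le (Finset.le_sup (f := depth) hc)⟩
  induction d generalizing s z S with
  | zero =>
    rw [Finset.eq_empty_of_forall_notMem fun c hc => absurd (hd c hc) (by omega)]
    simp
  | succ d ih =>
    -- The scan state decides what the root may be: only the parameter in `some 0`, only a leaf or
    -- an inner node otherwise. So the parameter, of weight one, never competes with other roots.
    by_cases hs : s = some 0
    · have hsub : S ⊆ {.x} := by
        intro c hc
        have := hS c hc
        subst hs
        cases c <;> simp [scan] at this ⊢
      refine (Finset.sum_le_sum_of_subset_of_nonneg hsub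
        fun c _ _ => weight_nonneg hp z c).trans ?_
      simp [weight]
    · obtain ⟨s', hs'⟩ : ∃ s' : Option ℕ, ∀ a (l r : PTree α),
          (node a l r).scan s = (l.scan s').bind r.scan := by
        rcases s with _ | _ | i
        · exact ⟨none, fun _ _ _ => rfl⟩
        · exact absurd rfl hs
        · exact ⟨some i, fun _ _ _ => rfl⟩
      have hx : PTree.x ∉ S := by
        intro hx
        have := hS _ hx
        rcases s with _ | _ | i <;> simp [scan] at this hs
      let D := S.filter fun c => ∃ a l r, c = node a l r
      let K := S.filter fun c => ∃ a, c = leaf a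
      let left : PTree α → PTree α := fun c => match c with
        | .node _ l _ => l
        | c => c
      let right : PTree α → PTree α := fun c => match c with
        | .node _ _ r => r
        | c => c
      let L := D.image left
      let R : PTree α → Finset (PTree α) := fun l => (D.filter fun c => left c = l).image right
      have hDmem : ∀ c ∈ D, ∃ a l r, c = node a l r ∧ (l.scan s').isSome ∧
          (∃ s'', l.scan s' = some s'' ∧ (r.scan s'').isSome) ∧ l.depth < d ∧ r.depth < d := by
        intro c hc
        obtain ⟨hcS, a, l, r, rfl⟩ := Finset.mem_filter.1 hc
        have h1 := hS _ hcS
        have h2 := hd _ hcS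
        rw [hs'] at h1
        simp only [depth] at h2
        refine ⟨a, l, r, rfl, ?_, ?_, by omega, by omega⟩
        · cases h : l.scan s' <;> simp [h] at h1 ⊢
        · cases h : l.scan s' with
          | none => simp [h] at h1
          | some s'' => exact ⟨s'', rfl, by simpa [h] using h1⟩
      have hnode : ∑ c ∈ D, c.weight step p z ≤ ∑ a, p z (a, true) := by
        refine sum_node_le hp z D L R ?_ ?_ ?_
        · intro c hc
          obtain ⟨a, l, r, rfl, -⟩ := hDmem c hc
          exact ⟨a, l, Finset.mem_image.2 ⟨_, hc, rfl⟩, r,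
            Finset.mem_image.2 ⟨_, Finset.mem_filter.2 ⟨hc, rfl⟩, rfl⟩, rfl⟩
        · intro a
          refine ih s' _ L ?_ ?_
          · intro l hl
            obtain ⟨c, hc, rfl⟩ := Finset.mem_image.1 hl
            obtain ⟨a, l, r, rfl, h, -⟩ := hDmem c hc
            exact h
          · intro l hl
            obtain ⟨c, hc, rfl⟩ := Finset.mem_image.1 hl
            obtain ⟨a, l, r, rfl, -, -, h, -⟩ := hDmem c hc
            exact h
        · intro a l hl
          -- All right subtrees that accompany a fixed `l` are scanned from the same state, namely
          -- the one in which `l` ends. This is why the sum is grouped by left subtree.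
          obtain ⟨s'', hs''⟩ : ∃ s'', l.scan s' = some s'' := by
            obtain ⟨c, hc, rfl⟩ := Finset.mem_image.1 hl
            obtain ⟨a, l, r, rfl, h, -⟩ := hDmem c hc
            exact Option.isSome_iff_exists.1 h
          refine ih s'' _ (R l) ?_ ?_
          · intro r hr
            obtain ⟨c, hc, rfl⟩ := Finset.mem_image.1 hr
            obtain ⟨hcD, rfl⟩ := Finset.mem_filter.1 hc
            obtain ⟨a, l, r, rfl, -, ⟨t, ht, h⟩, -⟩ := hDmem c hcD
            have : s'' = t := Option.some.inj (hs''.symm.trans ht)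
            exact this ▸ h
          · intro r hr
            obtain ⟨c, hc, rfl⟩ := Finset.mem_image.1 hr
            obtain ⟨hc, -⟩ := Finset.mem_filter.1 hc
            obtain ⟨a, l, r, rfl, -, -, -, h⟩ := hDmem c hc
            exact h
      have hleaf : ∑ c ∈ K, c.weight step p z ≤ ∑ a, p z (a, false) := by
        have hsub : K ⊆ Finset.univ.image (leaf : α → PTree α) := by
          intro c hc
          obtain ⟨-, a, rfl⟩ := Finset.mem_filter.1 hc
          simp
        refine (Finset.sum_le_sum_of_subset_of_nonneg hsub
          fun c _ _ => weight_nonneg hp z c).trans ?_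
        rw [Finset.sum_image (fun a _ b _ h => by simpa using h)]
        rfl
      have hSub : S ⊆ D ∪ K := by
        intro c hc
        cases c with
        | x => exact absurd hc hx
        | leaf a => exact Finset.mem_union_right _ (Finset.mem_filter.2 ⟨hc, a, rfl⟩)
        | node a l r =>
          exact Finset.mem_union_left _ (Finset.mem_filter.2 ⟨hc, a, l, r, rfl⟩)
      have hdisj : Disjoint D K := by
        rw [Finset.disjoint_left]
        intro c h1 h2
        obtain ⟨-, a, l, r, rfl⟩ := Finset.mem_filter.1 h1
        obtain ⟨-, b, hb⟩ := Finset.mem_filter.1 h2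
        simp at hb
      calc ∑ c ∈ S, c.weight step p z ≤ ∑ c ∈ D ∪ K, c.weight step p z :=
            Finset.sum_le_sum_of_subset_of_nonneg hSub fun c _ _ => weight_nonneg hp z c
        _ = ∑ c ∈ D, c.weight step p z + ∑ c ∈ K, c.weight step p z :=
            Finset.sum_union hdisj
        _ ≤ ∑ a, p z (a, true) + ∑ a, p z (a, false) := add_le_add hnode hleaf
        _ = ∑ b, p z b := by
            rw [Fintype.sum_prod_type, ← Finset.sum_add_distrib]
            simp
        _ ≤ 1 := hp1 z

/-- Contexts, discounted by the preorder index of the parameter, have total mass at most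
one. -/
theorem sum_weight_div_le_one [Fintype α] {step : Z → α × Bool → Z} {p : Z → α × Bool → ℝ}
    (hp : ∀ z b, 0 ≤ p z b) (hp1 : ∀ z, ∑ b, p z b ≤ 1) (z : Z)
    (S : Finset (PTree α)) (hS : ∀ c ∈ S, c.paramCount = 1) :
    ∑ c ∈ S, c.weight step p z / ((c.nodeCount + 2 : ℝ) ^ 2) ≤ 1 := by
  classical
  have hex : ∀ c : PTree α, ∃ i, c ∈ S → i ≤ c.nodeCount ∧ c.scan (some i) = some none := by
    intro c
    by_cases hc : c ∈ S
    · obtain ⟨i, hi⟩ := exists_scan_of_paramCount_eq_one (hS c hc)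
      exact ⟨i, fun _ => hi⟩
    · exact ⟨0, fun h => absurd h hc⟩
  choose idx hidx using hex
  have htel : ∀ n : ℕ, ∑ i ∈ Finset.range n, 1 / ((i + 1 : ℝ) * (i + 2)) = 1 - 1 / (n + 1) := by
    intro n
    induction n with
    | zero => simp
    | succ n ih =>
      rw [Finset.sum_range_succ, ih]
      push_cast
      field_simp
      ring
  let n := S.sup idx + 1
  have hmaps : ∀ c ∈ S, idx c ∈ Finset.range n := fun c hc =>
    Finset.mem_range.2 (Nat.lt_succ_of_le (Finset.le_sup (f := idx) hc))
  calc ∑ c ∈ S, c.weight step p z / ((c.nodeCount + 2 : ℝ) ^ 2)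
      -- The index is at most the number of nodes, so the discount in terms of size is at least as
      -- strong as the telescoping one in terms of the index.
      ≤ ∑ c ∈ S, 1 / ((idx c + 1 : ℝ) * (idx c + 2)) * c.weight step p z := by
        refine Finset.sum_le_sum fun c hc => ?_
        rw [div_eq_mul_one_div, mul_comm]
        refine mul_le_mul_of_nonneg_right ?_ (weight_nonneg hp z c)
        have h : (idx c : ℝ) ≤ c.nodeCount := by exact_mod_cast (hidx c hc).1
        have h0 : (0 : ℝ) ≤ idx c := by positivity
        refine one_div_le_one_div_of_le (by positivity) ?_
        nlinarith
    _ = ∑ i ∈ Finset.range n, ∑ c ∈ S with idx c = i,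
          1 / ((idx c + 1 : ℝ) * (idx c + 2)) * c.weight step p z :=
        (Finset.sum_fiberwise_of_maps_to hmaps _).symm
    _ = ∑ i ∈ Finset.range n, 1 / ((i + 1 : ℝ) * (i + 2)) *
          ∑ c ∈ S with idx c = i, c.weight step p z := by
        refine Finset.sum_congr rfl fun i _ => ?_
        rw [Finset.mul_sum]
        refine Finset.sum_congr rfl fun c hc => ?_
        rw [(Finset.mem_filter.1 hc).2]
    _ ≤ ∑ i ∈ Finset.range n, 1 / ((i + 1 : ℝ) * (i + 2)) * 1 := by
        refine Finset.sum_le_sum fun i _ => mul_le_mul_of_nonneg_left ?_ (by positivity)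
        refine sum_weight_le_one hp hp1 (some i) z _ fun c hc => ?_
        obtain ⟨hcS, rfl⟩ := Finset.mem_filter.1 hc
        simp [(hidx c hcS).2]
    _ ≤ 1 := by
        simp only [mul_one]
        rw [htel]
        have : (0 : ℝ) ≤ 1 / (n + 1) := by positivity
        linarith

end PTree

/-! ### Rearrangements of a word -/

theorem setOf_perm_eq_coe {ι : Type*} [DecidableEq ι] (w : List ι) :
    {v : List ι | v.Perm w} = (w.permutations.toFinset : Set (List ι)) := by
  ext v
  simp [List.mem_permutations]

/-- Expanding the power gives one term for each word of length `n`; `S` selects some of them. -/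
theorem sum_prod_map_le_pow {ι : Type*} [Fintype ι] {q : ι → ℝ} (hq : ∀ s, 0 ≤ q s) (n : ℕ)
    (S : Finset (List ι)) (hS : ∀ v ∈ S, v.length = n) :
    ∑ v ∈ S, (v.map q).prod ≤ (∑ s, q s) ^ n := by
  classical
  rw [Fintype.sum_pow]
  have hsub : S ⊆ (Finset.univ : Finset (Fin n → ι)).image List.ofFn := by
    intro v hv
    have hlen := hS v hv
    subst hlen
    exact Finset.mem_image.2 ⟨v.get, Finset.mem_univ _, List.ofFn_get v⟩
  refine (Finset.sum_le_sum_of_subset_of_nonneg hsub fun v _ _ => ?_).trans ?_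
  · refine List.prod_nonneg fun y hy => ?_
    obtain ⟨s, -, rfl⟩ := List.mem_map.1 hy
    exact hq s
  · rw [Finset.sum_image List.ofFn_injective.injOn]
    refine le_of_eq (Finset.sum_congr rfl fun f _ => ?_)
    rw [List.map_ofFn, List.prod_ofFn]
    rfl

/-- The number of rearrangements of a word is at most the inverse of its probability under
any memoryless source. -/
theorem ncard_perm_mul_prod_le_one {ι : Type*} [Fintype ι] {q : ι → ℝ} (hq : ∀ s, 0 ≤ q s)
    (hq1 : ∑ s, q s ≤ 1) (w : List ι) :
    ({v : List ι | v.Perm w}.ncard : ℝ) * (w.map q).prod ≤ 1 := by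
  classical
  rw [setOf_perm_eq_coe, Set.ncard_coe_finset]
  calc (w.permutations.toFinset.card : ℝ) * (w.map q).prod
      -- A memoryless source gives all rearrangements of `w` the same probability.
      = ∑ v ∈ w.permutations.toFinset, (v.map q).prod := by
        rw [← nsmul_eq_mul, ← Finset.sum_const]
        refine Finset.sum_congr rfl fun v hv => ?_
        have hv : v.Perm w := by simpa [List.mem_permutations] using hv
        exact (hv.map q).prod_eq.symm
    _ ≤ (∑ s, q s) ^ w.length := by
        refine sum_prod_map_le_pow hq _ _ fun v hv => ?_
        have hv : v.Perm w := by simpa [List.mem_permutations] using hv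
        exact hv.length_eq
    _ ≤ 1 := pow_le_one₀ (Finset.sum_nonneg fun s _ => hq s) hq1

/-! ### Values of the symbols of a grammar -/

namespace RawTSLP

variable {α : Type*} (G : RawTSLP α)

/-- The tree or context derived from a symbol, a letter being read as a leaf. -/
def symVal : α ⊕ Fin (G.p + 1) → PTree α
  | .inl a => .leaf a
  | .inr i => G.val i

variable {G}

theorem val_app {i j : Fin (G.p + 1)} {s : α ⊕ Fin (G.p + 1)} (h : G.rhs i = .app j s) :
    G.val i = (G.val j).subst (G.symVal s) := by
  rw [val]
  rcases s with a | k <;> split <;> simp_all [symVal]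

theorem val_comp {i j k : Fin (G.p + 1)} (h : G.rhs i = .comp j k) :
    G.val i = (G.val j).subst (G.val k) := by
  rw [val]
  split <;> simp_all

theorem val_nodeL {i : Fin (G.p + 1)} {a : α} {s : α ⊕ Fin (G.p + 1)}
    (h : G.rhs i = .nodeL a s) : G.val i = .node a (G.symVal s) .x := by
  rw [val]
  rcases s with b | k <;> split <;> simp_all [symVal]

theorem val_nodeR {i : Fin (G.p + 1)} {a : α} {s : α ⊕ Fin (G.p + 1)}
    (h : G.rhs i = .nodeR a s) : G.val i = .node a .x (G.symVal s) := by
  rw [val]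
  rcases s with b | k <;> split <;> simp_all [symVal]

variable (G)

/-- Nonterminals of rank `0` derive trees, those of rank `1` derive contexts. -/
theorem paramCount_val (i : Fin (G.p + 1)) : (G.val i).paramCount = (G.rhs i).rank := by
  induction i using G.wf_occurs.induction with
  | _ i ih =>
    have hsym : ∀ s ∈ (G.rhs i).rho, NFRhs.IsTreeSym G.rhs s → (G.symVal s).paramCount = 0 := by
      rintro (a | k) hs ht
      · rfl
      · exact (ih k hs).trans (ht k rfl)
    have hw := G.wellRanked i
    cases h : G.rhs i with
    | app j s =>
      rw [h] at hw hsym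
      rw [val_app h, PTree.paramCount_subst, hsym s (by simp [NFRhs.rho]) hw.2]
      simp [NFRhs.rank]
    | comp j k =>
      rw [h] at hw
      rw [val_comp h, PTree.paramCount_subst, ih j (by simp [Occurs, h, NFRhs.rho]),
        ih k (by simp [Occurs, h, NFRhs.rho]), hw.1, hw.2]
      simp [NFRhs.rank]
    | nodeL a s =>
      rw [h] at hw hsym
      rw [val_nodeL h, PTree.paramCount, hsym s (by simp [NFRhs.rho]) hw]
      simp [NFRhs.rank, PTree.paramCount]
    | nodeR a s =>
      rw [h] at hw hsym
      rw [val_nodeR h, PTree.paramCount, hsym s (by simp [NFRhs.rho]) hw]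
      simp [NFRhs.rank, PTree.paramCount]

theorem paramCount_val_of_wellRanked {j : Fin (G.p + 1)} (h : (G.rhs j).rank = 1) :
    (G.val j).paramCount = 1 := (G.paramCount_val j).trans h

/-- The number of nodes derived from a nonterminal is distributed over its right-hand
side. -/
theorem nodeCount_val (i : Fin (G.p + 1)) :
    (G.val i).nodeCount = ((G.rhs i).rho.map fun s => (G.symVal s).nodeCount).sum := by
  have hw := G.wellRanked i
  cases h : G.rhs i with
  | app j s =>
    rw [h] at hw
    rw [val_app h, PTree.nodeCount_subst (G.paramCount_val_of_wellRanked hw.1)]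
    simp [NFRhs.rho, symVal]
  | comp j k =>
    rw [h] at hw
    rw [val_comp h, PTree.nodeCount_subst (G.paramCount_val_of_wellRanked hw.1)]
    simp [NFRhs.rho, symVal]
  | nodeL a s =>
    rw [val_nodeL h]
    simp [NFRhs.rho, symVal, PTree.nodeCount]; omega
  | nodeR a s =>
    rw [val_nodeR h]
    simp [NFRhs.rho, symVal, PTree.nodeCount]; omega

section Likelihood

variable {Z : Type*} (step : Z → α × Bool → Z) (p : Z → α × Bool → ℝ)

/-- The largest probability of the piece derived from a symbol over all initial states. A
letter may stand for a leaf or for an inner node. -/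
noncomputable def likelihood : α ⊕ Fin (G.p + 1) → ℝ
  | .inl a => ⨆ z, max (p z (a, false)) (p z (a, true))
  | .inr i => ⨆ z, (G.val i).weight step p z

theorem weight_symVal_le_likelihood [Finite Z] (z : Z) (s : α ⊕ Fin (G.p + 1)) :
    (G.symVal s).weight step p z ≤ G.likelihood step p s := by
  rcases s with a | i
  · exact (le_max_left _ _).trans
      (le_ciSup (f := fun z => max (p z (a, false)) (p z (a, true)))
        (Set.finite_range _).bddAbove z)
  · exact le_ciSup (f := fun z => (G.val i).weight step p z) (Set.finite_range _).bddAbove z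

theorem apply_true_le_likelihood [Finite Z] (z : Z) (a : α) :
    p z (a, true) ≤ G.likelihood step p (.inl a) :=
  (le_max_right _ _).trans
    (le_ciSup (f := fun z => max (p z (a, false)) (p z (a, true)))
        (Set.finite_range _).bddAbove z)

variable {p}

theorem likelihood_nonneg (hp : ∀ z b, 0 ≤ p z b) (s : α ⊕ Fin (G.p + 1)) : 0 ≤ G.likelihood step p s := by
  rcases s with a | i
  · exact Real.iSup_nonneg fun z => (hp _ _).trans (le_max_left _ _)
  · exact Real.iSup_nonneg fun z => PTree.weight_nonneg hp z _

/-- The two pieces on the right-hand side are generated from some pair of states, and the suprema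
forget which. For a letter at an inner node this uses the second entry of the maximum in
`likelihood`. -/
theorem likelihood_le_prod_rho [Finite Z] [Nonempty Z] (hp : ∀ z b, 0 ≤ p z b)
    (i : Fin (G.p + 1)) :
    G.likelihood step p (.inr i) ≤ ((G.rhs i).rho.map (G.likelihood step p)).prod := by
  refine ciSup_le fun z => ?_
  have hw := G.wellRanked i
  have hsubst : ∀ j s, (G.rhs j).rank = 1 →
      ((G.val j).subst (G.symVal s)).weight step p z ≤
        G.likelihood step p (.inr j) * G.likelihood step p s := by
    intro j s hj
    obtain ⟨z', hz'⟩ := PTree.exists_weight_subst step p z (G.paramCount_val_of_wellRanked hj)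
    rw [hz']
    exact mul_le_mul (G.weight_symVal_le_likelihood step p z (.inr j))
      (G.weight_symVal_le_likelihood step p z' s) (PTree.weight_nonneg hp _ _)
      (G.likelihood_nonneg step hp _)
  have hnode : ∀ a s z', p z (a, true) * (G.symVal s).weight step p z' ≤
      G.likelihood step p (.inl a) * G.likelihood step p s := fun a s z' =>
    mul_le_mul (G.apply_true_le_likelihood step p z a)
      (G.weight_symVal_le_likelihood step p z' s) (PTree.weight_nonneg hp _ _)
      (G.likelihood_nonneg step hp _)
  cases h : G.rhs i with
  | app j s =>
    rw [h] at hw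
    rw [val_app h]
    simpa [NFRhs.rho] using hsubst j s hw.1
  | comp j k =>
    rw [h] at hw
    rw [val_comp h]
    simpa [NFRhs.rho, symVal] using hsubst j (.inr k) hw.1
  | nodeL a s =>
    rw [val_nodeL h]
    simpa [NFRhs.rho, PTree.weight] using hnode a s _
  | nodeR a s =>
    rw [val_nodeR h]
    simpa [NFRhs.rho, PTree.weight] using hnode a s _

end Likelihood

end RawTSLP

/-! ### Passing from the rules to the word `ω` -/

namespace ProperTSLP

variable {α : Type*} (G : ProperTSLP α)

theorem prod_map_rhoWord {M : Type*} [CommMonoid M] (f : α ⊕ Fin (G.p + 1) → M) :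
    (G.rhoWord.map f).prod = ∏ i, ((G.rhs i).rho.map f).prod := by
  simp [RawTSLP.rhoWord, List.map_flatten, List.prod_flatten, List.map_ofFn, List.prod_ofFn,
    Fin.prod_univ_succ]

/-- This is the cancellation between rules and `ω`. It is stated for any commutative monoid so that
it serves likelihoods and, through `Multiplicative`, node counts. -/
theorem prod_map_rhoWord_eq_mul {M : Type*} [CommMonoid M] (f : α ⊕ Fin (G.p + 1) → M) :
    (G.rhoWord.map f).prod = (∏ i : Fin G.p, f (.inr i.succ)) * (G.omegaWord.map f).prod := by
  rw [G.rhoWord_eq]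
  simp [omegaWord, List.map_flatten, List.prod_flatten, List.map_ofFn, List.prod_ofFn,
    Finset.prod_mul_distrib]

theorem length_rhoWord : G.rhoWord.length = 2 * (G.p + 1) := by
  have h : ∀ r : NFRhs α G.p, r.rho.length = 2 := by rintro (_ | _ | _ | _) <;> rfl
  simp [RawTSLP.rhoWord, List.length_flatten, List.map_ofFn, List.sum_ofFn, h]
  omega

theorem length_omegaWord : G.omegaWord.length = G.p + 2 := by
  have h1 := G.length_rhoWord
  rw [G.rhoWord_eq] at h1
  simp [List.length_flatten, List.map_ofFn, List.sum_ofFn, Finset.sum_add_distrib] at h1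
  simp [omegaWord, List.length_flatten, List.map_ofFn, List.sum_ofFn]
  omega

/-- The pieces derived from the symbols of `ω` have as many nodes as the tree. -/
theorem sum_nodeCount_omegaWord :
    (G.omegaWord.map fun s => (G.symVal s).nodeCount).sum = (G.val 0).nodeCount := by
  have h1 := G.prod_map_rhoWord
    (fun s => Multiplicative.ofAdd ((G.symVal s).nodeCount))
  rw [G.prod_map_rhoWord_eq_mul] at h1
  have h2 : ∀ l : List (α ⊕ Fin (G.p + 1)),
      (l.map fun s => Multiplicative.ofAdd ((G.symVal s).nodeCount)).prod =
        Multiplicative.ofAdd (l.map fun s => (G.symVal s).nodeCount).sum := by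
    intro l
    induction l with
    | nil => rfl
    | cons s l ih => simp [ih, ofAdd_add]
  simp only [h2, ← ofAdd_sum, ← ofAdd_add, ← G.nodeCount_val, EmbeddingLike.apply_eq_iff_eq] at h1
  rw [Fin.sum_univ_succ] at h1
  simp only [RawTSLP.symVal] at h1 ⊢
  omega

theorem exists_mem_rho (i : Fin G.p) : ∃ j, Sum.inr i.succ ∈ (G.rhs j).rho := by
  have h : Sum.inr i.succ ∈ G.rhoWord := by
    rw [G.rhoWord_eq, List.mem_flatten]
    exact ⟨_, List.mem_ofFn.2 ⟨i, rfl⟩, by simp⟩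
  rw [RawTSLP.rhoWord, List.mem_flatten] at h
  obtain ⟨l, hl, hi⟩ := h
  obtain ⟨j, rfl⟩ := List.mem_ofFn.1 hl
  exact ⟨j, hi⟩

variable {Z : Type*} [Finite Z] [Nonempty Z]
  (step : Z → α × Bool → Z) {p : Z → α × Bool → ℝ}

/-- Every nonterminal is used in the derivation of the tree. -/
theorem likelihood_pos (hp : ∀ z b, 0 ≤ p z b) (h0 : 0 < G.likelihood step p (.inr 0))
    (i : Fin (G.p + 1)) :
    0 < G.likelihood step p (.inr i) := by
  have hirr : Std.Irrefl (Relation.TransGen fun i j => Sum.inr j ∈ (G.rhs i).rho) := ⟨G.acyclic⟩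
  have hwf : WellFounded (Relation.TransGen fun i j => Sum.inr j ∈ (G.rhs i).rho) :=
    Finite.wellFounded_of_trans_of_irrefl _
  -- The induction runs from the start symbol downwards: a nonterminal other than `A_0` occurs in
  -- some right-hand side, and a zero factor there would make the likelihood of the user zero.
  induction i using hwf.induction with
  | _ i ih =>
    rcases Fin.eq_zero_or_eq_succ i with rfl | ⟨i, rfl⟩
    · exact h0
    · obtain ⟨j, hj⟩ := G.exists_mem_rho i
      have h1 := ih j (.single hj)
      have h2 := G.likelihood_le_prod_rho step hp j
      refine lt_of_le_of_ne (G.likelihood_nonneg step hp _) fun h => ?_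
      rw [List.prod_eq_zero (List.mem_map.2 ⟨_, hj, h.symm⟩)] at h2
      linarith

/-- The product of all rule inequalities has the likelihoods of `A_1, …, A_p` on both sides;
`likelihood_pos` allows dividing by them. -/
theorem likelihood_start_le_prod (hp : ∀ z b, 0 ≤ p z b)
    (h0 : 0 < G.likelihood step p (.inr 0)) :
    G.likelihood step p (.inr 0) ≤ (G.omegaWord.map (G.likelihood step p)).prod := by
  have hpos : 0 < ∏ i : Fin G.p, G.likelihood step p (.inr i.succ) :=
    Finset.prod_pos fun i _ => G.likelihood_pos step hp h0 _
  have h : ∏ i, G.likelihood step p (.inr i) ≤ (G.rhoWord.map (G.likelihood step p)).prod := by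
    rw [G.prod_map_rhoWord]
    exact Finset.prod_le_prod (fun i _ => G.likelihood_nonneg step hp _)
      fun i _ => G.likelihood_le_prod_rho step hp i
  rw [G.prod_map_rhoWord_eq_mul, Fin.prod_univ_succ, mul_comm] at h
  exact le_of_mul_le_mul_left h hpos

end ProperTSLP

/-! ### The number of rearrangements of `ω` -/

namespace ProperTSLP

variable {α : Type*} (G : ProperTSLP α) {Z : Type*}
  (step : Z → α × Bool → Z) (p : Z → α × Bool → ℝ)

/-- A memoryless source on the symbols: the initial state is averaged out, and the masses
are discounted by the number of nodes. -/
noncomputable def source [Fintype Z] : α ⊕ Fin (G.p + 1) → ℝ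
  | .inl a => (∑ z, (p z (a, false) + p z (a, true))) / (3 * Fintype.card Z)
  | .inr i => (∑ z, (G.val i).weight step p z / ((G.val i).nodeCount + 2 : ℝ) ^ 2) /
      (3 * Fintype.card Z)

variable {p}

theorem source_nonneg [Fintype Z] (hp : ∀ z b, 0 ≤ p z b) (s : α ⊕ Fin (G.p + 1)) : 0 ≤ G.source step p s := by
  rcases s with a | i
  · exact div_nonneg (Finset.sum_nonneg fun z _ => add_nonneg (hp _ _) (hp _ _)) (by positivity)
  · exact div_nonneg (Finset.sum_nonneg fun z _ =>
      div_nonneg (PTree.weight_nonneg hp _ _) (by positivity)) (by positivity)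

theorem sum_weight_val_le_two [Fintype α] (hp : ∀ z b, 0 ≤ p z b)
    (hp1 : ∀ z, ∑ b, p z b ≤ 1) (z : Z) :
    ∑ i, (G.val i).weight step p z / ((G.val i).nodeCount + 2 : ℝ) ^ 2 ≤ 2 := by
  classical
  let S : Finset (PTree α) := Finset.univ.image G.val
  have hmem : ∀ c ∈ S, c.paramCount = 0 ∨ c.paramCount = 1 := by
    intro c hc
    obtain ⟨i, -, rfl⟩ := Finset.mem_image.1 hc
    rw [G.paramCount_val]
    cases G.rhs i <;> simp [NFRhs.rank]
  have h0 : ∑ c ∈ S with c.paramCount = 0, c.weight step p z / (c.nodeCount + 2 : ℝ) ^ 2 ≤ 1 := by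
    refine (Finset.sum_le_sum fun c _ => ?_).trans
      (PTree.sum_weight_le_one (step := step) hp hp1 none z _ ?_)
    · refine div_le_self (PTree.weight_nonneg hp _ _) ?_
      have : (0 : ℝ) ≤ c.nodeCount := by positivity
      nlinarith
    · intro c hc
      simp [PTree.scan_none_of_paramCount_eq_zero (Finset.mem_filter.1 hc).2]
  have h1 : ∑ c ∈ S with ¬ c.paramCount = 0,
      c.weight step p z / (c.nodeCount + 2 : ℝ) ^ 2 ≤ 1 := by
    refine PTree.sum_weight_div_le_one hp hp1 z _ fun c hc => ?_
    obtain ⟨hc, h⟩ := Finset.mem_filter.1 hc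
    exact (hmem c hc).resolve_left h
  calc ∑ i, (G.val i).weight step p z / ((G.val i).nodeCount + 2 : ℝ) ^ 2
      -- Distinct nonterminals have distinct values, so the sum over nonterminals is one over a set
      -- of trees and contexts, to which Kraft's inequality applies.
      = ∑ c ∈ S, c.weight step p z / (c.nodeCount + 2 : ℝ) ^ 2 :=
        (Finset.sum_image (f := fun c : PTree α =>
          c.weight step p z / (c.nodeCount + 2 : ℝ) ^ 2) G.val_injective.injOn).symm
    _ ≤ 2 := by
        rw [← Finset.sum_filter_add_sum_filter_not S fun c => c.paramCount = 0]
        linarith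

/-- For each state the letters, the trees and the contexts have mass at most one each; hence the 3
in `source`. -/
theorem sum_source_le_one [Fintype α] [Fintype Z] [Nonempty Z] (hp : ∀ z b, 0 ≤ p z b)
    (hp1 : ∀ z, ∑ b, p z b ≤ 1) : ∑ s, G.source step p s ≤ 1 := by
  have hZ : (0 : ℝ) < Fintype.card Z := by exact_mod_cast Fintype.card_pos
  rw [Fintype.sum_sum_type]
  simp only [source]
  rw [← Finset.sum_div, ← Finset.sum_div, ← add_div, div_le_one (by positivity),
    Finset.sum_comm, Finset.sum_comm (s := (Finset.univ : Finset (Fin (G.p + 1)))),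
    ← Finset.sum_add_distrib]
  calc ∑ z, (∑ a, (p z (a, false) + p z (a, true)) +
        ∑ i, (G.val i).weight step p z / ((G.val i).nodeCount + 2 : ℝ) ^ 2)
      ≤ ∑ _z : Z, (3 : ℝ) := by
        refine Finset.sum_le_sum fun z _ => ?_
        have h1 : ∑ a, (p z (a, false) + p z (a, true)) ≤ 1 := by
          refine le_trans (le_of_eq ?_) (hp1 z)
          rw [Fintype.sum_prod_type]
          simp [add_comm]
        have h2 := G.sum_weight_val_le_two step hp hp1 z
        linarith
    _ = 3 * Fintype.card Z := by simp [mul_comm]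

/-- A supremum over the states is at most the sum over them, which costs the factor `Fintype.card
Z`. A letter counts as one node, so its square is 9, more than needed. -/
theorem likelihood_le_source [Fintype Z] [Nonempty Z] (hp : ∀ z b, 0 ≤ p z b)
    (s : α ⊕ Fin (G.p + 1)) :
    G.likelihood step p s ≤
      3 * Fintype.card Z * ((G.symVal s).nodeCount + 2 : ℝ) ^ 2 * G.source step p s := by
  have hZ : (0 : ℝ) < Fintype.card Z := by exact_mod_cast Fintype.card_pos
  rcases s with a | i
  · have hsum : 0 ≤ ∑ z, (p z (a, false) + p z (a, true)) :=
      Finset.sum_nonneg fun z _ => add_nonneg (hp _ _) (hp _ _)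
    have h1 : G.likelihood step p (.inl a) ≤ ∑ z, (p z (a, false) + p z (a, true)) := by
      refine ciSup_le fun z => ?_
      refine le_trans ?_ (Finset.single_le_sum (f := fun z => p z (a, false) + p z (a, true))
        (fun z _ => add_nonneg (hp _ _) (hp _ _)) (Finset.mem_univ z))
      exact max_le (le_add_of_nonneg_right (hp _ _)) (le_add_of_nonneg_left (hp _ _))
    have h2 : 3 * Fintype.card Z * ((G.symVal (.inl a)).nodeCount + 2 : ℝ) ^ 2 *
        G.source step p (.inl a) = 9 * ∑ z, (p z (a, false) + p z (a, true)) := by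
      simp only [source, RawTSLP.symVal, PTree.nodeCount]
      field_simp
      norm_num [mul_comm]
    rw [h2]
    linarith
  · have h2 : 3 * Fintype.card Z * ((G.symVal (.inr i)).nodeCount + 2 : ℝ) ^ 2 *
        G.source step p (.inr i) = ∑ z, (G.val i).weight step p z := by
      simp only [source, RawTSLP.symVal, ← Finset.sum_div]
      field_simp
    rw [h2]
    exact ciSup_le fun z => Finset.single_le_sum (f := fun z => (G.val i).weight step p z)
      (fun z _ => PTree.weight_nonneg hp _ _) (Finset.mem_univ z)

/-- The number of rearrangements of `ω` in terms of the probability of the tree. -/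
theorem ncard_perm_mul_weight_le [Fintype α] [Fintype Z] [Nonempty Z]
    (hp : ∀ z b, 0 ≤ p z b) (hp1 : ∀ z, ∑ b, p z b ≤ 1) (z : Z) (hz : 0 < (G.val 0).weight step p z) :
    ({v : List (α ⊕ Fin (G.p + 1)) | v.Perm G.omegaWord}.ncard : ℝ) *
        (G.val 0).weight step p z ≤
      (G.omegaWord.map fun s =>
        3 * Fintype.card Z * ((G.symVal s).nodeCount + 2 : ℝ) ^ 2).prod := by
  have h0 : (G.val 0).weight step p z ≤ G.likelihood step p (.inr 0) :=
    G.weight_symVal_le_likelihood step p z (.inr 0)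
  have h1 := h0.trans (G.likelihood_start_le_prod step hp (hz.trans_le h0))
  have h2 : (G.omegaWord.map (G.likelihood step p)).prod ≤
      (G.omegaWord.map fun s => 3 * Fintype.card Z * ((G.symVal s).nodeCount + 2 : ℝ) ^ 2 *
        G.source step p s).prod :=
    List.prod_map_le_prod_map₀ _ _ (fun s _ => G.likelihood_nonneg step hp s)
      fun s _ => G.likelihood_le_source step hp s
  rw [List.prod_map_mul] at h2
  have h3 := ncard_perm_mul_prod_le_one (G.source_nonneg step hp)
    (G.sum_source_le_one step hp hp1) G.omegaWord
  have h4 : 0 ≤ (G.omegaWord.map fun s =>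
      3 * Fintype.card Z * ((G.symVal s).nodeCount + 2 : ℝ) ^ 2).prod := by
    refine List.prod_nonneg fun y hy => ?_
    obtain ⟨s, -, rfl⟩ := List.mem_map.1 hy
    positivity
  calc _ ≤ ({v : List (α ⊕ Fin (G.p + 1)) | v.Perm G.omegaWord}.ncard : ℝ) * _ :=
        mul_le_mul_of_nonneg_left (h1.trans h2) (by positivity)
    _ = (G.omegaWord.map fun s =>
          3 * Fintype.card Z * ((G.symVal s).nodeCount + 2 : ℝ) ^ 2).prod *
        (({v : List (α ⊕ Fin (G.p + 1)) | v.Perm G.omegaWord}.ncard : ℝ) *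
          (G.omegaWord.map (G.source step p)).prod) := by ring
    _ ≤ _ := mul_le_of_le_one_right h4 h3

end ProperTSLP

/-! ### The empirical entropy as a log-likelihood -/

namespace BTree

variable {α : Type*}

/-- The `k`-history of a child in terms of the `k`-history of its parent. -/
def pushHistory {k : ℕ} (z : List.Vector (α × Bool) k) (b : α × Bool) :
    List.Vector (α × Bool) k :=
  ⟨(z.toList ++ [b]).drop 1, by simp⟩

/-- The `k`-history of a node if the root has the `k`-history `z`. -/
def historyFrom {k : ℕ} (z : List.Vector (α × Bool) k) (t : BTree α) (v : List Bool) :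
    List.Vector (α × Bool) k :=
  ⟨(z.toList ++ t.history v).drop (t.history v).length, by simp⟩

theorem historyFrom_cons_false {k : ℕ} (z : List.Vector (α × Bool) k) (a : α) (l r : BTree α)
    (v : List Bool) :
    historyFrom z (node a l r) (false :: v) = historyFrom (pushHistory z (a, false)) l v := by
  apply Subtype.ext
  simp only [historyFrom, pushHistory, history, List.Vector.toList_mk]
  rw [← List.drop_append_of_le_length (by simp), List.drop_drop]
  simp [add_comm]

theorem historyFrom_cons_true {k : ℕ} (z : List.Vector (α × Bool) k) (a : α) (l r : BTree α)
    (v : List Bool) :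
    historyFrom z (node a l r) (true :: v) = historyFrom (pushHistory z (a, true)) r v := by
  apply Subtype.ext
  simp only [historyFrom, pushHistory, history, List.Vector.toList_mk]
  rw [← List.drop_append_of_le_length (by simp), List.drop_drop]
  simp [add_comm]

theorem historyFrom_nil {k : ℕ} (z : List.Vector (α × Bool) k) (t : BTree α) :
    historyFrom z t [] = z := by
  apply Subtype.ext
  cases t <;> simp [historyFrom, history, List.Vector.toList]

theorem label_isSome {t : BTree α} {v : List Bool} (hv : v ∈ t.nodes) :
    ∃ b, t.label v = some b := by
  induction t generalizing v with
  | leaf a => simp [nodes] at hv; subst hv; exact ⟨_, rfl⟩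
  | node a l r ihl ihr =>
    simp only [nodes, Finset.mem_insert, Finset.mem_union, Finset.mem_image] at hv
    rcases hv with rfl | ⟨w, hw, rfl⟩ | ⟨w, hw, rfl⟩
    · exact ⟨_, rfl⟩
    · exact ihl hw
    · exact ihr hw

theorem weight_toPTree {k : ℕ} (p : List.Vector (α × Bool) k → α × Bool → ℝ)
    (z : List.Vector (α × Bool) k) (t : BTree α) :
    t.toPTree.weight pushHistory p z =
      ∏ v ∈ t.nodes, ((t.label v).elim 1 (p (historyFrom z t v))) := by
  induction t generalizing z with
  | leaf a => simp [toPTree, PTree.weight, nodes, label, historyFrom_nil]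
  | node a l r ihl ihr =>
    simp only [toPTree, PTree.weight, nodes]
    rw [Finset.prod_insert (by simp), Finset.prod_union, Finset.prod_image (by simp),
      Finset.prod_image (by simp), ihl, ihr, historyFrom_nil]
    · simp only [label, historyFrom_cons_false, historyFrom_cons_true, Option.elim]
      ring
    · rw [Finset.disjoint_left]
      intro w h1 h2
      simp only [Finset.mem_image] at h1 h2
      obtain ⟨u, -, rfl⟩ := h1
      obtain ⟨u', -, h⟩ := h2
      simp at h

theorem nodeCount_toPTree (t : BTree α) : t.toPTree.nodeCount + 1 = 2 * t.leaves := by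
  induction t with
  | leaf a => rfl
  | node a l r ihl ihr => simp only [toPTree, PTree.nodeCount, leaves]; omega

variable (box : α) (k : ℕ) (t : BTree α)

theorem kHistory_eq (v : List Bool) :
    t.kHistory box k v = (historyFrom (List.Vector.replicate k (box, false)) t v).toList := rfl

variable [DecidableEq α]

theorem empirical_nonneg (z : List (α × Bool)) (b : α × Bool) : 0 ≤ t.empirical box k z b := by
  unfold empirical
  positivity

theorem empirical_pos {v : List Bool} (hv : v ∈ t.nodes) {b : α × Bool}
    (hb : t.label v = some b) : 0 < t.empirical box k (t.kHistory box k v) b := by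
  refine div_pos ?_ ?_ <;> refine Nat.cast_pos.2 (Finset.card_pos.2 ⟨v, ?_⟩) <;> simp [hv, hb]

/-- The probability of the tree under its own empirical process. -/
noncomputable def selfWeight : ℝ :=
  t.toPTree.weight pushHistory (fun z b => t.empirical box k z.toList b)
    (List.Vector.replicate k (box, false))

theorem selfWeight_pos : 0 < t.selfWeight box k := by
  rw [selfWeight, weight_toPTree]
  refine Finset.prod_pos fun v hv => ?_
  obtain ⟨b, hb⟩ := label_isSome hv
  rw [hb]
  exact t.empirical_pos box k hv hb

variable [Fintype α]

theorem sum_histLabelCount (z : List (α × Bool)) :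
    ∑ b, t.histLabelCount box k z b = t.histCount box k z := by
  unfold histCount histLabelCount
  rw [← Finset.card_biUnion]
  · congr 1
    ext v
    simp only [Finset.mem_biUnion, Finset.mem_univ, true_and, Finset.mem_filter]
    constructor
    · rintro ⟨b, h, h', -⟩
      exact ⟨h, h'⟩
    · rintro ⟨h, h'⟩
      obtain ⟨b, hb⟩ := label_isSome h
      exact ⟨b, h, h', hb⟩
  · intro b _ b' _ hbb
    rw [Function.onFun, Finset.disjoint_left]
    intro v h1 h2
    simp only [Finset.mem_filter] at h1 h2
    exact hbb (Option.some.inj (h1.2.2.symm.trans h2.2.2))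

/-- Only an inequality: at a history that does not occur, the division `0 / 0 = 0` makes the sum
zero. -/
theorem sum_empirical_le_one (z : List (α × Bool)) : ∑ b, t.empirical box k z b ≤ 1 := by
  unfold empirical
  rw [← Finset.sum_div, ← Nat.cast_sum, sum_histLabelCount]
  exact div_self_le_one _

theorem empiricalEntropy_eq :
    t.empiricalEntropy box k = -Real.logb 2 (t.selfWeight box k) := by
  have hsum : Real.logb 2 (t.selfWeight box k) = ∑ v ∈ t.nodes,
      Real.logb 2 ((t.label v).elim 1 (t.empirical box k (t.kHistory box k v))) := by
    rw [selfWeight, weight_toPTree, Real.logb_prod]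
    · rfl
    · intro v hv
      obtain ⟨b, hb⟩ := label_isSome hv
      rw [hb]
      exact (t.empirical_pos box k hv hb).ne'
  have hfib : ∑ v ∈ t.nodes,
      Real.logb 2 ((t.label v).elim 1 (t.empirical box k (t.kHistory box k v))) =
      ∑ z : List.Vector (α × Bool) k, ∑ b, (t.histLabelCount box k z.toList b : ℝ) *
        Real.logb 2 (t.empirical box k z.toList b) := by
    rw [← Finset.sum_fiberwise t.nodes
      (fun v => historyFrom (List.Vector.replicate k (box, false)) t v)]
    refine Finset.sum_congr rfl fun z _ => ?_
    rw [← Finset.sum_fiberwise _ t.label, Fintype.sum_option]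
    -- The fibre of label `none` contributes `logb 2 1 = 0`.
    rw [Finset.sum_eq_zero, zero_add]
    · refine Finset.sum_congr rfl fun b _ => ?_
      rw [histLabelCount, ← nsmul_eq_mul, ← Finset.sum_const, Finset.filter_filter]
      refine Finset.sum_congr ?_ ?_
      · ext v
        rw [Finset.mem_filter, Finset.mem_filter, kHistory_eq]
        refine and_congr_right fun _ => and_congr_left fun _ => ?_
        exact ⟨fun h => h ▸ rfl, fun h => Subtype.ext h⟩
      · intro v hv
        simp only [Finset.mem_filter] at hv
        rw [hv.2.1, hv.2.2]
        rfl
    · intro v hv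
      simp only [Finset.mem_filter] at hv
      rw [hv.2]
      simp
  rw [hsum, hfib, empiricalEntropy, ← Finset.sum_neg_distrib]
  refine Finset.sum_congr rfl fun z _ => ?_
  rw [shannonEntropy, Finset.mul_sum, ← Finset.sum_neg_distrib]
  refine Finset.sum_congr rfl fun b _ => ?_
  have h : (t.histCount box k z.toList : ℝ) * t.empirical box k z.toList b =
      t.histLabelCount box k z.toList b := by
    unfold empirical
    by_cases h0 : t.histCount box k z.toList = 0
    · have h1 := t.sum_histLabelCount box k z.toList
      rw [h0, Finset.sum_eq_zero_iff] at h1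
      simp [h0, h1 b (Finset.mem_univ b)]
    · field_simp
  rw [← h]
  ring

end BTree

/-! ### The length of the encoding -/

/-- Tangent line bound for the logarithm. -/
theorem Real.logb_two_le_logb_add {y l : ℝ} (hy : 0 < y) (hl : 0 < l) :
    Real.logb 2 y ≤ Real.logb 2 l + 2 * (y / l) := by
  have h1 : Real.logb 2 y = Real.logb 2 l + Real.logb 2 (y / l) := by
    rw [Real.logb_div hy.ne' hl.ne']; ring
  -- The factor 2 is a rounding of `1 / log 2`.
  have h2 : Real.logb 2 (y / l) ≤ 2 * (y / l) := by
    have hpos : 0 < y / l := by positivity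
    rw [Real.logb, div_le_iff₀ (Real.log_pos (by norm_num))]
    have := Real.log_le_sub_one_of_pos hpos
    have := Real.log_two_gt_d9
    nlinarith
  linarith

/-- Needed in `length_w3_le` to apply `sum_count_eq_length` to `ρ`. -/
theorem Sum.lawfulBEq {ι κ : Type*} [BEq ι] [LawfulBEq ι] [BEq κ] [LawfulBEq κ] :
    LawfulBEq (ι ⊕ κ) where
  eq_of_beq := by
    rintro (a | a) (b | b) h
    · exact congrArg Sum.inl (eq_of_beq (show (a == b) = true from h))
    · exact absurd (show false = true from h) Bool.false_ne_true
    · exact absurd (show false = true from h) Bool.false_ne_true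
    · exact congrArg Sum.inr (eq_of_beq (show (a == b) = true from h))
  rfl := by
    rintro (a | a)
    · exact (show (a == a) = true from beq_self_eq_true a)
    · exact (show (a == a) = true from beq_self_eq_true a)

theorem sum_count_eq_length {ι : Type*} [Fintype ι] [BEq ι] [LawfulBEq ι] (w : List ι) :
    ∑ s, w.count s = w.length := by
  classical
  induction w with
  | nil => simp
  | cons a w ih => simp [List.count_cons, Finset.sum_add_distrib, ih]

namespace ProperTSLP

variable {α : Type*} (G : ProperTSLP α)

theorem length_w0 : G.w0.length = G.p + 1 := by simp [w0]

theorem length_w1 : G.w1.length = 2 * (G.p + 1) := by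
  have h : ∀ r : NFRhs α G.p, r.typeBits.length = 2 := by rintro (_ | _ | _ | _) <;> rfl
  simp [w1, List.length_flatten, List.map_ofFn, List.sum_ofFn, h]
  omega

theorem length_w2 : G.w2.length = 2 * (G.p + 1) := by
  have h := G.length_omegaWord
  simp [omegaWord, List.length_flatten, List.map_ofFn, List.sum_ofFn] at h
  simp [w2, List.length_flatten, List.map_ofFn, List.sum_ofFn, Finset.sum_add_distrib]
  omega

theorem length_w3_le [Fintype α] [LinearOrder α] :
    G.w3.length ≤ 3 * (G.p + 1) + Fintype.card α := by
  have h1 : ∑ s, G.rhoWord.count s = 2 * (G.p + 1) := by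
    rw [← G.length_rhoWord]
    have := Sum.lawfulBEq (ι := α) (κ := Fin (G.p + 1))
    exact sum_count_eq_length _
  rw [Fintype.sum_sum_type, Fin.sum_univ_succ] at h1
  have h2 : ∀ f : α → ℕ,
      (((Finset.univ : Finset α).sort (· ≤ ·)).map f).sum = ∑ a, f a := by
    intro f
    rw [← Multiset.sum_coe, ← Multiset.map_coe, Finset.sort_eq]
    rfl
  have h3 : ∑ i : Fin G.p, (G.rhoWord.count (.inr i.succ) - 1) ≤
      ∑ i : Fin G.p, G.rhoWord.count (.inr i.succ) :=
    Finset.sum_le_sum fun i _ => Nat.sub_le _ _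
  simp only [w3, List.length_append, List.length_flatten, List.map_ofFn, List.sum_ofFn,
    List.length_flatMap, h2, Function.comp_apply, List.length_replicate, List.length_singleton,
    Finset.sum_add_distrib, Finset.sum_const, Finset.card_univ, Fintype.card_fin, smul_eq_mul,
    mul_one]
  omega

theorem length_w4_le [LinearOrder α] :
    (G.w4.length : ℝ) ≤
      Real.logb 2 {v : List (α ⊕ Fin (G.p + 1)) | v.Perm G.omegaWord}.ncard + 1 := by
  have h : G.w4.length =
      Nat.clog 2 {v : List (α ⊕ Fin (G.p + 1)) | v.Perm G.omegaWord}.ncard := by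
    simp [w4, enumerativeCode]
  have h0 : 0 < {v : List (α ⊕ Fin (G.p + 1)) | v.Perm G.omegaWord}.ncard := by
    rw [setOf_perm_eq_coe, Set.ncard_coe_finset, Finset.card_pos]
    exact ⟨G.omegaWord, by simp [List.mem_permutations]⟩
  rw [h, ← Real.natCeil_logb_natCast]
  push_cast
  refine (Nat.ceil_lt_add_one (Real.logb_nonneg (by norm_num) ?_)).le
  exact_mod_cast h0

/-- The length of `w₄` in terms of the empirical entropy and an arbitrary threshold `l`. -/
theorem logb_ncard_perm_le [Fintype α] [DecidableEq α] (box : α) (k : ℕ) (t : BTree α)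
    (ht : G.val 0 = t.toPTree) {l : ℝ} (hl : 0 < l) :
    Real.logb 2 {v : List (α ⊕ Fin (G.p + 1)) | v.Perm G.omegaWord}.ncard ≤
      t.empiricalEntropy box k + (G.p + 2) *
        (Real.logb 2 3 + k * Real.logb 2 (2 * Fintype.card α) + 2 * Real.logb 2 l) +
      4 * ((2 * t.leaves + 2 * (G.p + 2)) / l) := by
  have hZ : Nonempty (List.Vector (α × Bool) k) := ⟨List.Vector.replicate k (box, false)⟩
  have hα : (0 : ℝ) < Fintype.card α := by exact_mod_cast Fintype.card_pos_iff.2 ⟨box⟩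
  have hcard : (Fintype.card (List.Vector (α × Bool) k) : ℝ) = (2 * Fintype.card α) ^ k := by
    rw [card_vector, Fintype.card_prod, Fintype.card_bool]
    push_cast
    rw [mul_comm]
  have hpos := t.selfWeight_pos box k
  have hmain := G.ncard_perm_mul_weight_le BTree.pushHistory
    (p := fun z b => t.empirical box k z.toList b) (fun z b => t.empirical_nonneg box k _ b)
    (fun z => t.sum_empirical_le_one box k _) (List.Vector.replicate k (box, false))
    (by rw [ht]; exact hpos)
  rw [ht] at hmain
  change _ * t.selfWeight box k ≤ _ at hmain
  have h0 : (0 : ℝ) < {v : List (α ⊕ Fin (G.p + 1)) | v.Perm G.omegaWord}.ncard := by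
    rw [setOf_perm_eq_coe, Set.ncard_coe_finset, Nat.cast_pos, Finset.card_pos]
    exact ⟨G.omegaWord, by simp [List.mem_permutations]⟩
  have hlog := Real.logb_le_logb_of_le (b := 2) (by norm_num) (mul_pos h0 hpos) hmain
  rw [Real.logb_mul h0.ne' hpos.ne', hcard] at hlog
  set c := Real.logb 2 3 + k * Real.logb 2 (2 * Fintype.card α) + 2 * Real.logb 2 l with hc
  have hbound : ∀ w : List (α ⊕ Fin (G.p + 1)),
      0 < (w.map fun s => 3 * (2 * (Fintype.card α : ℝ)) ^ k *
        ((G.symVal s).nodeCount + 2 : ℝ) ^ 2).prod ∧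
      Real.logb 2 (w.map fun s => 3 * (2 * (Fintype.card α : ℝ)) ^ k *
        ((G.symVal s).nodeCount + 2 : ℝ) ^ 2).prod ≤
      -- The 4 is the exponent 2 of the discount times the 2 of the tangent bound.
      w.length * c + 4 * ((((w.map fun s => (G.symVal s).nodeCount).sum : ℕ) +
        2 * w.length) / l) := by
    intro w
    induction w with
    | nil => simp
    | cons s w ih =>
      obtain ⟨ih0, ih⟩ := ih
      have hs : (0 : ℝ) < (G.symVal s).nodeCount + 2 := by positivity
      have hlogs := Real.logb_two_le_logb_add hs hl
      refine ⟨by simp only [List.map_cons, List.prod_cons]; positivity, ?_⟩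
      simp only [List.map_cons, List.prod_cons, List.sum_cons, List.length_cons]
      rw [Real.logb_mul (by positivity) ih0.ne', Real.logb_mul (by positivity) (by positivity),
        Real.logb_mul (by norm_num) (by positivity), Real.logb_pow, Real.logb_pow]
      rw [Nat.cast_add, Nat.cast_add, Nat.cast_one]
      have hsplit : ∀ x y z : ℝ, 4 * ((x + y + 2 * (z + 1)) / l) =
          4 * ((x + 2) / l) + 4 * ((y + 2 * z) / l) := by
        intro x y z; field_simp; ring
      rw [hsplit]
      linarith
  have h1 := (hbound G.omegaWord).2
  rw [G.sum_nodeCount_omegaWord, G.length_omegaWord, ht] at h1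
  have h2 : ((t.toPTree.nodeCount : ℕ) : ℝ) ≤ 2 * t.leaves := by
    have := t.nodeCount_toPTree
    exact_mod_cast (by omega : t.toPTree.nodeCount ≤ 2 * t.leaves)
  have h3 : 4 * (((t.toPTree.nodeCount : ℝ) + 2 * (G.p + 2)) / l) ≤
      4 * ((2 * t.leaves + 2 * (G.p + 2)) / l) := by gcongr
  rw [t.empiricalEntropy_eq]
  push_cast at h1
  linarith

end ProperTSLP

theorem NormalFormTSLP.length_encode_le {α : Type*} [Fintype α] [LinearOrder α] (box : α) (k : ℕ)
    (t : BTree α) (ht : 2 ≤ t.leaves) (G : NormalFormTSLP α) (hG : G.val = t.toPTree) {l : ℝ}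
    (hl : 0 < l) :
    (G.encode.length : ℝ) ≤ t.empiricalEntropy box k + (G.size + 1) *
        (Real.logb 2 3 + k * Real.logb 2 (2 * Fintype.card α) + 2 * Real.logb 2 l) +
      4 * ((2 * t.leaves + 2 * (G.size + 1)) / l) + 8 * G.size + 1 + Fintype.card α := by
  cases G with
  | single a =>
    cases t with
    | leaf b => simp [BTree.leaves] at ht
    | node b l r => simp [val, BTree.toPTree] at hG
  | proper G =>
    have h0 := G.length_w0
    have h1 := G.length_w1
    have h2 := G.length_w2
    have h3 := G.length_w3_le
    have h4 := G.length_w4_le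
    have h5 := G.logb_ncard_perm_le box k t hG hl
    have h6 : ((NormalFormTSLP.proper G).encode.length : ℝ) ≤
        8 * (G.p + 1) + Fintype.card α + G.w4.length := by
      simp only [encode, List.length_append]
      exact_mod_cast (by omega)
    simp only [size]
    push_cast
    have h7 : ((G.p : ℝ) + 1 + 1) = G.p + 2 := by ring
    rw [h7]
    linarith

/-! ### The main estimate -/

theorem Real.logb_two_three_le : Real.logb 2 3 ≤ 2 := by
  rw [Real.logb_le_iff_le_rpow (by norm_num) (by norm_num)]
  norm_num

theorem Real.logb_two_le_three_div_four_mul {y : ℝ} (hy : 0 < y) :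
    Real.logb 2 y ≤ 3 / 4 * y := by
  have h := Real.add_one_le_exp (Real.log y - 1)
  rw [Real.exp_sub, Real.exp_log hy, sub_add_cancel, le_div_iff₀ (Real.exp_pos 1)] at h
  have he := Real.exp_one_gt_d9
  have h2 := Real.log_two_gt_d9
  rw [Real.logb, div_le_iff₀ (by linarith)]
  by_cases hpos : 0 ≤ Real.log y
  · nlinarith
  · have : 0 < 3 / 4 * y * Real.log 2 := by positivity
    linarith

/-- The first estimate, with an explicit constant. -/
theorem length_encode_le_main {γ : ℝ} {α : Type*} [Fintype α] [LinearOrder α]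
    (box : α) (k : ℕ) (t : BTree α) (ht : 2 ≤ t.leaves) (G : NormalFormTSLP α)
    (hG : G.val = t.toPTree) (hsize : (G.size : ℝ) ≤ γ * (t.leaves / logSigma α t.leaves)) :
    (G.encode.length : ℝ) ≤ t.empiricalEntropy box k +
      (25 * γ + 8) * (t.leaves / logSigma α t.leaves *
        (k * Real.logb 2 (sigmaHat α) + max 1 (Real.logb 2 (logSigma α t.leaves)))) +
      Fintype.card α := by
  have hσ2 : (2 : ℝ) ≤ sigmaHat α := by exact_mod_cast le_max_left 2 (Fintype.card α)
  have hσ : (Fintype.card α : ℝ) ≤ sigmaHat α := by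
    exact_mod_cast le_max_right 2 (Fintype.card α)
  have hα : (0 : ℝ) < Fintype.card α := by exact_mod_cast Fintype.card_pos_iff.2 ⟨box⟩
  have hn : (2 : ℝ) ≤ t.leaves := by exact_mod_cast ht
  have hℓ : 0 < logSigma α t.leaves := Real.logb_pos (by linarith) (by linarith)
  set ℓ := logSigma α t.leaves
  set L := Real.logb 2 (sigmaHat α) with hL
  set D := max 1 (Real.logb 2 ℓ) with hD
  set m : ℝ := (G.size : ℝ) with hm
  have hm1 : 1 ≤ m := by
    rw [hm]
    cases G <;> simp [NormalFormTSLP.size]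
  have hL0 : 0 ≤ L := Real.logb_nonneg (by norm_num) (by linarith)
  have hlam : Real.logb 2 (max 2 ℓ) = D := by
    rcases le_total ℓ 2 with h | h
    · rw [max_eq_left h, hD, max_eq_left, Real.logb_self_eq_one (by norm_num)]
      rw [← Real.logb_self_eq_one (b := 2) (by norm_num)]
      exact Real.logb_le_logb_of_le (by norm_num) hℓ h
    · rw [max_eq_right h, hD, max_eq_right]
      rw [← Real.logb_self_eq_one (b := 2) (by norm_num)]
      exact Real.logb_le_logb_of_le (by norm_num) (by norm_num) h
  -- This threshold has logarithm exactly `D`, and being at least 2 and at least `ℓ` it keeps the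
  -- quotient term of order `m + N`.
  have hmain := G.length_encode_le box k t ht hG (l := max 2 ℓ) (by positivity)
  rw [hlam] at hmain
  have hcard : Real.logb 2 (2 * Fintype.card α) ≤ 2 * L := by
    have : Real.logb 2 ((sigmaHat α : ℝ) ^ 2) = 2 * L := by rw [Real.logb_pow]; norm_num [hL]
    rw [← this]
    exact Real.logb_le_logb_of_le (by norm_num) (by positivity) (by nlinarith)
  have hD1 : 1 ≤ D := le_max_left _ _
  have hkL : 0 ≤ (k : ℝ) * L := by positivity
  have h3 := Real.logb_two_three_le
  have hA : (m + 1) * (Real.logb 2 3 + k * Real.logb 2 (2 * Fintype.card α) + 2 * D) ≤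
      (2 * m) * (2 + 2 * (k * L) + 2 * D) := by
    have hk : (k : ℝ) * Real.logb 2 (2 * Fintype.card α) ≤ 2 * (k * L) := by
      have := mul_le_mul_of_nonneg_left hcard (Nat.cast_nonneg (α := ℝ) k)
      linarith
    calc (m + 1) * (Real.logb 2 3 + k * Real.logb 2 (2 * Fintype.card α) + 2 * D)
        ≤ (m + 1) * (2 + 2 * (k * L) + 2 * D) :=
          mul_le_mul_of_nonneg_left (by linarith) (by linarith)
      _ ≤ _ := mul_le_mul_of_nonneg_right (by linarith) (by linarith)
  have hB : 4 * ((2 * t.leaves + 2 * (m + 1)) / max 2 ℓ) ≤ 8 * (t.leaves / ℓ) + 8 * m := by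
    have e1 : 2 * (t.leaves : ℝ) / max 2 ℓ ≤ 2 * t.leaves / ℓ :=
      div_le_div_of_nonneg_left (by positivity) hℓ (le_max_right _ _)
    have e2 : 2 * (m + 1) / max 2 ℓ ≤ 2 * (m + 1) / 2 :=
      div_le_div_of_nonneg_left (by positivity) (by norm_num) (le_max_left _ _)
    rw [add_div]
    have e3 : 2 * (t.leaves : ℝ) / ℓ = 2 * (t.leaves / ℓ) := by ring
    linarith
  set N := (t.leaves : ℝ) / ℓ
  have hN : 0 ≤ N := by positivity
  have hC : (25 * m + 8 * N) * (k * L + D) ≤ (25 * γ + 8) * (N * (k * L + D)) := by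
    have := mul_le_mul_of_nonneg_right (by linarith : 25 * m + 8 * N ≤ (25 * γ + 8) * N)
      (by linarith : 0 ≤ k * L + D)
    linarith
  -- As `1 ≤ m` and `1 ≤ D`, the terms `4m + 16m + 1` are at most `21 m D`; with `4 m D` this makes
  -- 25.
  have hE : 2 * m * (2 + 2 * (k * L) + 2 * D) + 8 * N + 8 * m + 8 * m + 1 ≤
      (25 * m + 8 * N) * (k * L + D) := by
    have e1 : 0 ≤ m * (k * L) := by positivity
    have e2 : 0 ≤ N * (k * L) := by positivity
    have e3 : m ≤ m * D := le_mul_of_one_le_right (by linarith) hD1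
    have e4 : N ≤ N * D := le_mul_of_one_le_right hN hD1
    nlinarith
  linarith

theorem mainTheorem1 (γ : ℝ) (hγ : 0 < γ) :
    ∃ C : ℝ, 0 < C ∧
      ∀ (α : Type*) [Fintype α] [LinearOrder α] (box : α) (ψ : TreeCompressor α) (n : ℕ),
        2 ≤ n →
        (∀ t : BTree α, t.leaves = n → ((ψ.tslp t).size : ℝ) ≤ γ * (n / logSigma α n)) →
        ∀ t : BTree α, t.leaves = n → ∀ k : ℕ,
          ((ψ.encode t).length : ℝ) ≤ t.empiricalEntropy box k
              + C * (k * n * Real.logb 2 (sigmaHat α) / logSigma α n)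
              + C * (n * max 1 (Real.logb 2 (logSigma α n)) / logSigma α n)
              + Fintype.card α ∧
          ((1 ≤ k ∨ sigmaHat α ^ 2 ≤ n) →
            ((ψ.encode t).length : ℝ) ≤ t.empiricalEntropy box k
              + C * (k * n * Real.logb 2 (sigmaHat α) / logSigma α n)
              + C * (n * Real.logb 2 (logSigma α n) / logSigma α n)
              + Fintype.card α) := by
  refine ⟨8 * (25 * γ + 8), by positivity, ?_⟩
  intro α _ _ box ψ n hn hψ t ht k
  subst ht
  have hσ2 : (2 : ℝ) ≤ sigmaHat α := by exact_mod_cast le_max_left 2 (Fintype.card α)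
  have hn2 : (2 : ℝ) ≤ t.leaves := by exact_mod_cast hn
  have hℓ : 0 < logSigma α t.leaves := Real.logb_pos (by linarith) (by linarith)
  have hmain : ((ψ.encode t).length : ℝ) ≤ _ :=
    length_encode_le_main box k t hn (ψ.tslp t) (ψ.val_tslp t) (hψ t rfl)
  have hℓeq : Real.logb 2 (logSigma α t.leaves) =
      Real.logb 2 (Real.logb 2 t.leaves) - Real.logb 2 (Real.logb 2 (sigmaHat α)) := by
    have h1 : logSigma α t.leaves = Real.logb 2 t.leaves / Real.logb 2 (sigmaHat α) :=
      (div_div_div_cancel_right₀ (Real.log_pos (by norm_num)).ne' _ _).symm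
    rw [h1, Real.logb_div (Real.logb_pos (by norm_num) (by linarith)).ne'
      (Real.logb_pos (by norm_num) (by linarith)).ne']
  -- For `n` below `σ̂` this logarithm is negative. It is at least `-log₂ log₂ σ̂`, hence at least
  -- minus a fraction below 1 of `log₂ σ̂`, so for `k ≥ 1` the term with `k` absorbs it.
  have hlow : -(3 / 4 * Real.logb 2 (sigmaHat α)) ≤ Real.logb 2 (logSigma α t.leaves) := by
    have h1 : 0 ≤ Real.logb 2 (Real.logb 2 t.leaves) := by
      refine Real.logb_nonneg (by norm_num) ?_
      rw [Real.le_logb_iff_rpow_le (by norm_num) (by linarith)]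
      simpa using hn2
    have h2 := Real.logb_two_le_three_div_four_mul
      (Real.logb_pos (b := 2) (x := sigmaHat α) (by norm_num) (by linarith))
    linarith
  have hL1 : 1 ≤ Real.logb 2 (sigmaHat α) := by
    rw [Real.le_logb_iff_rpow_le (by norm_num) (by linarith)]
    simpa using hσ2
  have hsq : sigmaHat α ^ 2 ≤ t.leaves → 1 ≤ Real.logb 2 (logSigma α t.leaves) := by
    intro h
    rw [Real.le_logb_iff_rpow_le (by norm_num) hℓ, Real.rpow_one, logSigma,
      Real.le_logb_iff_rpow_le (by linarith) (by linarith)]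
    exact_mod_cast h
  set ℓ := logSigma α t.leaves
  set L := Real.logb 2 (sigmaHat α)
  set N := (t.leaves : ℝ) / ℓ with hNdef
  have hN : 0 ≤ N := by positivity
  have hB : 0 ≤ (25 * γ + 8) * N := by positivity
  have e1 : (k : ℝ) * t.leaves * L / ℓ = N * (k * L) := by rw [hNdef]; ring
  have e2 : ∀ y : ℝ, (t.leaves : ℝ) * y / ℓ = N * y := by intro y; rw [hNdef]; ring
  rw [e1, e2, e2]
  have hkL : 0 ≤ (k : ℝ) * L := by positivity
  have key : ∀ y : ℝ, k * L + max 1 (Real.logb 2 ℓ) ≤ 8 * (k * L + y) →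
      ((ψ.encode t).length : ℝ) ≤ t.empiricalEntropy box k +
        8 * (25 * γ + 8) * (N * (k * L)) + 8 * (25 * γ + 8) * (N * y) + Fintype.card α := by
    intro y hy
    have := mul_le_mul_of_nonneg_left hy hB
    linarith
  refine ⟨key _ ?_, fun hor => key _ ?_⟩
  · have : 1 ≤ max 1 (Real.logb 2 ℓ) := le_max_left _ _
    linarith
  · rcases hor with hk | h
    · have hk1 : L ≤ k * L := le_mul_of_one_le_left (by linarith) (by exact_mod_cast hk)
      rcases le_total 1 (Real.logb 2 ℓ) with h | h
      · rw [max_eq_right h]; linarith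
      -- Here `8 (kL + y) ≥ 8kL - 6L ≥ 2kL ≥ kL + 1`, where `y` is the iterated logarithm; this is
      -- where the factor 8 in the constant is used.
      · rw [max_eq_left h]; linarith
    · have h := hsq h
      rw [max_eq_right h]; linarith
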